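/- Let $\alpha,\beta\ge 0$. A $\mathbb{Z}_2\mathbb{Z}_4$-additive code is a subgroup $\mathcal{C}$ of $\mathbb{Z}_2^\alpha\times\mathbb{Z}_4^\beta$. It is of type $(\alpha,\beta;\gamma,\delta;\kappa)$ if $\mathcal{C}\cong\mathbb{Z}_2^\gamma\times\mathbb{Z}_4^\delta$ as a group and $\kappa$ is the dimension of the binary linear code obtained by projecting $\mathcal{C}_b=\{x\in\mathcal{C}: 2x=0\}$ to the $\alpha$ binary coordinates. Its dual is $$\mathcal{C}^\perp=\Big\{v : 2\sum_{i=1}^{\alpha}u_iv_i+\sum_{j=1}^{\beta}u'_jv'_j=0\in\mathbb{Z}_4\ \text{ for all } u=(u\mid u')\in\mathcal{C}\Big\},\qquad v=(v\mid v')\in\mathbb{Z}_2^\alpha\times\mathbb{Z}_4^\beta .$$ The code $\mathcal{C}$ is 1-perfect if its binary image $\Phi(\mathcal{C})\subseteq\mathbb{Z}_2^{\alpha+2\beta}$ is 1-perfect, where $\Phi$ is the identity on the binary coordinates and the Gray map $0\mapsto 00,\ 1\mapsto 01,\ 2\mapsto 11,\ 3\mapsto 10$ on each quaternary coordinate, and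 a binary code is 1-perfect if every binary vector is at Hamming distance at most one from exactly one codeword. **Proposition 2.3.** Let $r,t$ be integers with $2\le r\le t\le 2r$, and let $\mathcal{C}_{r,t}\subseteq\mathbb{Z}_2^\alpha\times\mathbb{Z}_4^\beta$ be any $\mathbb{Z}_2\mathbb{Z}_4$-additive 1-perfect code of binary length $\alpha+2\beta=2^t-1$ with $\alpha=2^r-1$ binary coordinates. Then: (i) $\mathcal{C}_{r,t}$ is of type $(\alpha,\beta;\gamma,\delta;\kappa)$ exactly for $$\alpha=2^r-1,\quad \beta=2^{t-1}-2^{r-1},\quad \gamma=2^r-1-2r+t,\quad \delta=2^{t-1}-2^{r-1}+r-t,\quad \kappa=\gamma.$$ (ii) $(\mathcal{C}_{r,t})^\perp$ is of type $(\bar\alpha,\bar\beta;\bar\gamma,\bar\delta;\bar\kappa)$ exactly for $$\bar\alpha=\alpha,\quad \bar\beta=\beta,\quad \bar\gamma=2r-t,\quad \bar\delta=t-r,\quad \bar\kappa=\bar\gamma.$$ -/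

import Mathlib

/-- The ambient group `ℤ₂^α × ℤ₄^β`; a vector is written `u = (u.1 | u.2)`. -/
abbrev Z2Z4 (α β : ℕ) : Type := (Fin α → ZMod 2) × (Fin β → ZMod 4)

/-- The classical Gray map `ℤ₄ → ℤ₂²`: `0 ↦ 00`, `1 ↦ 01`, `2 ↦ 11`, `3 ↦ 10`. -/
def grayDigit (a : ZMod 4) : Fin 2 → ZMod 2 :=
  if a = 0 then ![0, 0] else if a = 1 then ![0, 1] else if a = 2 then ![1, 1] else ![1, 0]

/-- The extended Gray map `Φ : ℤ₂^α × ℤ₄^β → ℤ₂^(α + 2β)`. The `α + 2β` binary coordinates are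
indexed by `Fin α ⊕ (Fin β × Fin 2)`. -/
def grayMap {α β : ℕ} (u : Z2Z4 α β) : Fin α ⊕ (Fin β × Fin 2) → ZMod 2 :=
  Sum.elim u.1 (fun p => grayDigit (u.2 p.1) p.2)

/-- A binary code is 1-perfect if the Hamming balls of radius one around its codewords partition
the space: every vector is at Hamming distance at most one from exactly one codeword. -/
def IsBinaryOnePerfect {ι : Type*} [Fintype ι] (C : Set (ι → ZMod 2)) : Prop :=
  ∀ v : ι → ZMod 2, ∃! c : ι → ZMod 2, c ∈ C ∧ hammingDist v c ≤ 1

/-- A `ℤ₂ℤ₄`-additive code is 1-perfect if its binary Gray image is 1-perfect. -/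
def IsOnePerfect {α β : ℕ} (C : AddSubgroup (Z2Z4 α β)) : Prop :=
  IsBinaryOnePerfect (grayMap '' (C : Set (Z2Z4 α β)))

/-- The inner product `2 (∑ uᵢ vᵢ) + ∑ u'ⱼ v'ⱼ ∈ ℤ₄`, where the binary coordinates are read as
the quaternary digits zero and one. -/
def innerZ4 {α β : ℕ} (u v : Z2Z4 α β) : ZMod 4 :=
  2 * (∑ i, ((u.1 i).val : ZMod 4) * ((v.1 i).val : ZMod 4)) + ∑ j, u.2 j * v.2 j

theorem innerZ4_zero_right {α β : ℕ} (u : Z2Z4 α β) : innerZ4 u 0 = 0 := by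
  simp [innerZ4]

theorem innerZ4_add_right {α β : ℕ} (u v w : Z2Z4 α β) :
    innerZ4 u (v + w) = innerZ4 u v + innerZ4 u w := by
  have h : ∀ a b c : ZMod 2, (2 : ZMod 4) * ((a.val : ZMod 4) * ((b + c).val : ZMod 4)) =
      2 * ((a.val : ZMod 4) * (b.val : ZMod 4)) + 2 * ((a.val : ZMod 4) * (c.val : ZMod 4)) := by
    decide
  simp only [innerZ4, Finset.mul_sum, Prod.fst_add, Prod.snd_add, Pi.add_apply, h, mul_add,
    Finset.sum_add_distrib]
  abel

/-- The dual code `C^⊥` (all vectors orthogonal to every codeword), as a `ℤ₂ℤ₄`-additive code. -/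
def dualCode {α β : ℕ} (C : AddSubgroup (Z2Z4 α β)) : AddSubgroup (Z2Z4 α β) where
  carrier := {v | ∀ u ∈ C, innerZ4 u v = 0}
  zero_mem' := fun u _ => innerZ4_zero_right u
  add_mem' := fun {v w} hv hw u hu => by rw [innerZ4_add_right, hv u hu, hw u hu, add_zero]
  neg_mem' := fun {v} hv u hu => by
    have h := innerZ4_add_right u v (-v)
    rw [add_neg_cancel, innerZ4_zero_right, hv u hu, zero_add] at h
    exact h.symm

/-- The subcode `C_b` of `C` formed by the codewords of order two and the zero codeword. -/
def orderTwoSubcode {α β : ℕ} (C : AddSubgroup (Z2Z4 α β)) : AddSubgroup (Z2Z4 α β) where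
  carrier := {x | x ∈ C ∧ 2 • x = 0}
  zero_mem' := ⟨C.zero_mem, smul_zero 2⟩
  add_mem' := fun {x y} hx hy => ⟨C.add_mem hx.1 hy.1, by rw [smul_add, hx.2, hy.2, add_zero]⟩
  neg_mem' := fun {x} hx => ⟨C.neg_mem hx.1, by rw [smul_neg, hx.2, neg_zero]⟩

/-- The punctured code `C_X`: the projection of `C` to the `α` binary coordinates, which is a
binary linear code. -/
def punctureX {α β : ℕ} (C : AddSubgroup (Z2Z4 α β)) : Submodule (ZMod 2) (Fin α → ZMod 2) :=
  AddSubgroup.toZModSubmodule 2 (C.map (AddMonoidHom.fst (Fin α → ZMod 2) (Fin β → ZMod 4)))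

/-- `C` is a `ℤ₂ℤ₄`-additive code of type `(a, b; γ, δ; κ)`. -/
structure IsOfType {α β : ℕ} (C : AddSubgroup (Z2Z4 α β)) (a b γ δ κ : ℕ) : Prop where
  /-- The number of binary coordinates is `a`. -/
  binary_coords : α = a
  /-- The number of quaternary coordinates is `b`. -/
  quaternary_coords : β = b
  /-- As a group, `C` is isomorphic to `ℤ₂^γ × ℤ₄^δ`. -/
  group_type : Nonempty (C ≃+ (Fin γ → ZMod 2) × (Fin δ → ZMod 4))
  /-- The binary linear code `(C_b)_X` has dimension `κ`. -/
  dim_eq : Module.finrank (ZMod 2) (punctureX (orderTwoSubcode C)) = κ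

/-!
A 1-perfect code `C` in `G = ℤ₂^α × ℤ₄^β` has the vectors of Lee weight at most one as a transversal
of `G ⧸ C`. This transversal is closed under negation, and negation detects 2-torsion, so its
`α + 1` elements of order at most two represent exactly the 2-torsion of `G ⧸ C`. Hence
`|G ⧸ C| = 2 ^ t` and `|(G ⧸ C)[2]| = 2 ^ r`, and counting `C`, `C ∩ G[2]` and `C ∩ 2G` gives the
type of `C`: the kernel of the projection of `C_b` to the binary coordinates is `C ∩ 2G`.

For the dual code, `|C^⊥ ∩ D^⊥|` is determined by `|C|`, `|D|` and `|C ∩ D|`. Since `G[2]` and `2G`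
are dual to each other, the type of `C` determines the type of `C^⊥`.
-/

section Groups

variable {G H : Type*} [AddGroup G] [AddGroup H]

theorem card_inf_ker_mul_card_map (f : G →+ H) (N : AddSubgroup G) :
    Nat.card (N ⊓ f.ker : AddSubgroup G) * Nat.card (N.map f) = Nat.card N := by
  rw [← AddSubgroup.relIndex_ker, ← AddSubgroup.inf_relIndex_left,
    ← AddSubgroup.relIndex_bot_left, ← AddSubgroup.relIndex_bot_left]
  exact AddSubgroup.relIndex_mul_relIndex _ _ _ bot_le inf_le_left

theorem card_inf_mul_card_map_mk (C N : AddSubgroup G) [C.Normal] :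
    Nat.card (C ⊓ N : AddSubgroup G) * Nat.card (N.map (QuotientAddGroup.mk' C)) =
      Nat.card N := by
  rw [← card_inf_ker_mul_card_map (QuotientAddGroup.mk' C) N, QuotientAddGroup.ker_mk', inf_comm]

theorem card_sup_mul_card_inf (C N : AddSubgroup G) [C.Normal] :
    Nat.card (C ⊔ N : AddSubgroup G) * Nat.card (C ⊓ N : AddSubgroup G) =
      Nat.card C * Nat.card N := by
  have hC : C.map (QuotientAddGroup.mk' C) = ⊥ :=
    (AddSubgroup.map_eq_bot_iff C).2 (QuotientAddGroup.ker_mk' C).ge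
  have hsup := card_inf_mul_card_map_mk C (C ⊔ N)
  rw [AddSubgroup.map_sup, hC, bot_sup_eq, inf_sup_self] at hsup
  rw [← hsup, ← card_inf_mul_card_map_mk C N]
  ring

end Groups

section TwoTorsion

variable {A B : Type*} [AddCommGroup A] [AddCommGroup B]

variable (A) in
/-- The 2-torsion subgroup `{x | 2x = 0}` of an abelian group. For `A = ℤ₂^α × ℤ₄^β` it cuts `C_b`
out of a code `C`. -/
def twoTorsion : AddSubgroup A := (nsmulAddMonoidHom (α := A) 2).ker

variable (A) in
/-- The subgroup `2A = {2x}` of an abelian group. For `A = ℤ₂^α × ℤ₄^β` it consists of the elements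
of order at most two that vanish on the binary coordinates, and is orthogonal to the 2-torsion. -/
def doubles : AddSubgroup A := (nsmulAddMonoidHom (α := A) 2).range

theorem mem_twoTorsion {x : A} : x ∈ twoTorsion A ↔ 2 • x = 0 := Iff.rfl

theorem mem_doubles {x : A} : x ∈ doubles A ↔ ∃ y, 2 • y = x := Iff.rfl

theorem mem_twoTorsion_iff_neg_eq {x : A} : x ∈ twoTorsion A ↔ -x = x := by
  rw [mem_twoTorsion, two_nsmul, neg_eq_iff_add_eq_zero]

variable (A) in
theorem card_twoTorsion_mul_card_doubles :
    Nat.card (twoTorsion A) * Nat.card (doubles A) = Nat.card A := by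
  rw [doubles, ← AddSubgroup.index_ker]
  exact AddSubgroup.card_mul_index _

theorem map_doubles_of_surjective {f : A →+ B} (hf : Function.Surjective f) :
    (doubles A).map f = doubles B := by
  ext x
  simp only [AddSubgroup.mem_map, mem_doubles, exists_exists_eq_and, map_nsmul]
  exact (hf.exists (p := fun y => 2 • y = x)).symm

theorem card_twoTorsion_congr (e : A ≃+ B) :
    Nat.card (twoTorsion A) = Nat.card (twoTorsion B) :=
  Nat.card_congr <| e.toEquiv.subtypeEquiv fun x => by
    change 2 • x = 0 ↔ 2 • e x = 0
    rw [← map_nsmul, EmbeddingLike.map_eq_zero_iff]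

variable (A B) in
theorem card_twoTorsion_prod :
    Nat.card (twoTorsion (A × B)) = Nat.card (twoTorsion A) * Nat.card (twoTorsion B) := by
  rw [← Nat.card_prod]
  exact Nat.card_congr <| (Equiv.subtypeEquivRight fun _ => Prod.ext_iff).trans <|
    Equiv.subtypeProdEquivProd (p := (2 • · = (0 : A))) (q := (2 • · = (0 : B)))

variable (A) in
theorem card_twoTorsion_pi (ι : Type*) [Fintype ι] :
    Nat.card (twoTorsion (ι → A)) = Nat.card (twoTorsion A) ^ Fintype.card ι := by
  rw [← Nat.card_eq_fintype_card, ← Nat.card_fun]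
  exact Nat.card_congr <| (Equiv.subtypeEquivRight fun _ => funext_iff).trans <|
    Equiv.subtypePiEquivPi (p := fun _ => (2 • · = (0 : A)))

theorem card_inf_twoTorsion (C : AddSubgroup A) :
    Nat.card (C ⊓ twoTorsion A : AddSubgroup A) = Nat.card (twoTorsion C) :=
  Nat.card_congr <| (Equiv.subtypeSubtypeEquivSubtypeInter (· ∈ C) (· ∈ twoTorsion A)).symm.trans <|
    Equiv.subtypeEquivRight fun _ => by
      rw [mem_twoTorsion, mem_twoTorsion, Subtype.ext_iff, AddSubgroup.coe_nsmul,
        ZeroMemClass.coe_zero]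

theorem bijOn_inter_twoTorsion {f : A →+ B} {S : Set A} (hS : ∀ x ∈ S, -x ∈ S)
    (hf : Set.BijOn f S Set.univ) :
    Set.BijOn f (S ∩ twoTorsion A) (twoTorsion B) := by
  refine ⟨fun x hx => ?_, hf.injOn.mono Set.inter_subset_left, fun y hy => ?_⟩
  · rw [SetLike.mem_coe, mem_twoTorsion_iff_neg_eq, ← map_neg, mem_twoTorsion_iff_neg_eq.1 hx.2]
  · obtain ⟨x, hx, rfl⟩ := hf.surjOn (Set.mem_univ y)
    have hneg : f (-x) = f x := (map_neg f x).trans (mem_twoTorsion_iff_neg_eq.1 hy)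
    exact ⟨x, ⟨hx, mem_twoTorsion_iff_neg_eq.2 (hf.injOn (hS x hx) hx hneg)⟩, rfl⟩

end TwoTorsion

theorem exists_pi_zmod_addEquiv_Z2Z4 {ι : Type*} [Finite ι] {n : ι → ℕ}
    (hn : ∀ i, n i = 2 ∨ n i = 4) : ∃ γ δ : ℕ, Nonempty ((∀ i, ZMod (n i)) ≃+ Z2Z4 γ δ) := by
  classical
  have := Fintype.ofFinite ι
  have hn4 (i : {i // n i ≠ 2}) : n i = 4 := (hn i).resolve_left i.2
  let split := RingEquiv.piEquivPiSubtypeProd (fun i => n i = 2) (fun i => ZMod (n i))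
  let binary := (RingEquiv.piCongrRight fun i : {i // n i = 2} => ZMod.ringEquivCongr i.2).trans
    (RingEquiv.piCongrLeft (fun _ => ZMod 2) (Fintype.equivFin _))
  let quaternary := (RingEquiv.piCongrRight fun i => ZMod.ringEquivCongr (hn4 i)).trans
    (RingEquiv.piCongrLeft (fun _ => ZMod 4) (Fintype.equivFin _))
  exact ⟨_, _, ⟨(split.trans (binary.prodCongr quaternary)).toAddEquiv⟩⟩

theorem exists_addEquiv_Z2Z4 {A : Type*} [AddCommGroup A] [Finite A] (hA : ∀ x : A, 4 • x = 0) :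
    ∃ γ δ : ℕ, Nonempty (A ≃+ Z2Z4 γ δ) := by
  classical
  obtain ⟨ι, _, n, hn, ⟨e⟩⟩ := AddCommGroup.equiv_directSum_zmod_of_finite' A
  let e' : A ≃+ (∀ i, ZMod (n i)) := e.trans (DirectSum.addEquivProd _)
  have hdvd (i : ι) : n i ∣ 4 := by
    have h := congrArg e' (hA (e'.symm (Pi.single i 1)))
    rw [map_nsmul, e'.apply_symm_apply, map_zero] at h
    have hi : 4 • (1 : ZMod (n i)) = 0 := by simpa using! congrFun h i
    rwa [nsmul_one, ZMod.natCast_eq_zero_iff] at hi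
  have hn24 (i : ι) : n i = 2 ∨ n i = 4 := by
    have hle := Nat.le_of_dvd (by norm_num) (hdvd i)
    have := hdvd i
    have := hn i
    interval_cases n i <;> omega
  obtain ⟨γ, δ, ⟨f⟩⟩ := exists_pi_zmod_addEquiv_Z2Z4 hn24
  exact ⟨γ, δ, ⟨e'.trans f⟩⟩

section Z2Z4

variable {α β : ℕ}

theorem card_Z2Z4 (α β : ℕ) : Nat.card (Z2Z4 α β) = 2 ^ (α + 2 * β) := by
  simp [pow_add, pow_mul]

theorem four_nsmul_Z2Z4 (x : Z2Z4 α β) : 4 • x = 0 := by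
  have h2 : ∀ a : ZMod 2, 4 • a = 0 := by decide
  have h4 : ∀ a : ZMod 4, 4 • a = 0 := by decide
  exact Prod.ext (funext fun i => h2 _) (funext fun j => h4 _)

theorem card_twoTorsion_Z2Z4 (α β : ℕ) : Nat.card (twoTorsion (Z2Z4 α β)) = 2 ^ (α + β) := by
  have h2 : Nat.card {a : ZMod 2 // 2 • a = 0} = 2 := by rw [Nat.card_eq_fintype_card]; decide
  have h4 : Nat.card {a : ZMod 4 // 2 • a = 0} = 2 := by rw [Nat.card_eq_fintype_card]; decide
  rw [card_twoTorsion_prod, card_twoTorsion_pi, card_twoTorsion_pi, pow_add,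
    Fintype.card_fin, Fintype.card_fin]
  exact congrArg₂ (· ^ α * · ^ β) h2 h4

theorem card_doubles_Z2Z4 (α β : ℕ) : Nat.card (doubles (Z2Z4 α β)) = 2 ^ β := by
  have h := card_twoTorsion_mul_card_doubles (Z2Z4 α β)
  rw [card_twoTorsion_Z2Z4, card_Z2Z4, two_mul, ← add_assoc, pow_add _ (α + β)] at h
  exact Nat.eq_of_mul_eq_mul_left (by positivity) h

theorem twoTorsion_inf_ker_fst (α β : ℕ) :
    twoTorsion (Z2Z4 α β) ⊓ (AddMonoidHom.fst (Fin α → ZMod 2) (Fin β → ZMod 4)).ker =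
      doubles (Z2Z4 α β) := by
  have h2 : ∀ a : ZMod 2, 2 • a = 0 := by decide
  have h4 : ∀ a : ZMod 4, 2 • 2 • a = 0 := by decide
  have half : ∀ y : ZMod 4, 2 • y = 0 → ∃ a : ZMod 4, 2 • a = y := by decide
  ext x
  constructor
  · rintro ⟨htors, hfst⟩
    choose w hw using fun j => half (x.2 j) (congrFun (congrArg Prod.snd htors) j)
    exact ⟨(0, w), Prod.ext ((smul_zero 2).trans hfst.symm) (funext hw)⟩
  · rintro ⟨y, rfl⟩
    exact ⟨Prod.ext (funext fun i => h2 _) (funext fun j => h4 _), funext fun i => h2 _⟩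

end Z2Z4

section TypeOfCode

variable {α β : ℕ} {C : AddSubgroup (Z2Z4 α β)} {a b γ δ κ : ℕ}

theorem exists_isOfType (C : AddSubgroup (Z2Z4 α β)) : ∃ γ δ κ, IsOfType C α β γ δ κ := by
  obtain ⟨γ, δ, hC⟩ := exists_addEquiv_Z2Z4 fun x : C => Subtype.ext (four_nsmul_Z2Z4 x.1)
  exact ⟨γ, δ, _, rfl, rfl, hC, rfl⟩

theorem orderTwoSubcode_eq_inf (C : AddSubgroup (Z2Z4 α β)) :
    orderTwoSubcode C = C ⊓ twoTorsion (Z2Z4 α β) := rfl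

theorem card_inf_doubles_mul_card_punctureX (C : AddSubgroup (Z2Z4 α β)) :
    Nat.card (C ⊓ doubles (Z2Z4 α β) : AddSubgroup (Z2Z4 α β)) *
      Nat.card (punctureX (orderTwoSubcode C)) = Nat.card (orderTwoSubcode C) := by
  have h := card_inf_ker_mul_card_map
    (AddMonoidHom.fst (Fin α → ZMod 2) (Fin β → ZMod 4)) (orderTwoSubcode C)
  rwa [orderTwoSubcode_eq_inf, inf_assoc, twoTorsion_inf_ker_fst] at h

theorem IsOfType.card_eq (h : IsOfType C a b γ δ κ) : Nat.card C = 2 ^ (γ + 2 * δ) := by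
  obtain ⟨e⟩ := h.group_type
  rw [Nat.card_congr e.toEquiv, card_Z2Z4]

theorem IsOfType.card_inf_twoTorsion (h : IsOfType C a b γ δ κ) :
    Nat.card (C ⊓ twoTorsion (Z2Z4 α β) : AddSubgroup (Z2Z4 α β)) = 2 ^ (γ + δ) := by
  obtain ⟨e⟩ := h.group_type
  rw [_root_.card_inf_twoTorsion, card_twoTorsion_congr e, card_twoTorsion_Z2Z4]

theorem IsOfType.card_inf_doubles_mul (h : IsOfType C a b γ δ κ) :
    Nat.card (C ⊓ doubles (Z2Z4 α β) : AddSubgroup (Z2Z4 α β)) * 2 ^ κ = 2 ^ (γ + δ) := by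
  have hκ : Nat.card (punctureX (orderTwoSubcode C)) = 2 ^ κ := by
    rw [Module.natCard_eq_pow_finrank (K := ZMod 2), Nat.card_zmod, h.dim_eq]
  rw [← hκ, card_inf_doubles_mul_card_punctureX, orderTwoSubcode_eq_inf, h.card_inf_twoTorsion]

end TypeOfCode

section Duality

variable {α β : ℕ}

theorem innerZ4_comm (u v : Z2Z4 α β) : innerZ4 u v = innerZ4 v u := by
  simp only [innerZ4, mul_comm]

theorem innerZ4_add_left (u v w : Z2Z4 α β) :
    innerZ4 (u + v) w = innerZ4 u w + innerZ4 v w := by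
  rw [innerZ4_comm, innerZ4_add_right, innerZ4_comm w, innerZ4_comm w]

theorem innerZ4_two_nsmul_left (u v : Z2Z4 α β) : innerZ4 (2 • u) v = innerZ4 u (2 • v) := by
  rw [two_nsmul, two_nsmul, innerZ4_add_left, innerZ4_add_right]

theorem innerZ4_single_fst (i : Fin α) (v : Z2Z4 α β) :
    innerZ4 (Pi.single i 1, 0) v = 2 * ((v.1 i).val : ZMod 4) := by
  have hval : (1 : ZMod 2).val = 1 := rfl
  rw [innerZ4, Finset.sum_eq_single i (fun k _ hk => by simp [hk]) (by simp)]
  simp [hval]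

theorem innerZ4_single_snd (j : Fin β) (v : Z2Z4 α β) : innerZ4 (0, Pi.single j 1) v = v.2 j := by
  simp [innerZ4, Pi.single_apply]

theorem addMonoidHom_pi_zmod_ext {ι A : Type*} [Finite ι] [DecidableEq ι] [AddCommMonoid A] {n : ℕ}
    [NeZero n] {f g : (ι → ZMod n) →+ A} (h : ∀ i, f (Pi.single i 1) = g (Pi.single i 1)) :
    f = g := by
  refine AddMonoidHom.functions_ext _ _ _ fun i x => ?_
  have hx : (Pi.single i x : ι → ZMod n) = x.val • Pi.single i 1 := by
    rw [← Pi.single_smul, nsmul_one, ZMod.natCast_zmod_val]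
  rw [hx, map_nsmul, map_nsmul, h]

theorem addMonoidHom_Z2Z4_ext {A : Type*} [AddCommMonoid A] {f g : Z2Z4 α β →+ A}
    (hfst : ∀ i, f (Pi.single i 1, 0) = g (Pi.single i 1, 0))
    (hsnd : ∀ j, f (0, Pi.single j 1) = g (0, Pi.single j 1)) : f = g := by
  have hinl : f.comp (AddMonoidHom.inl _ _) = g.comp (AddMonoidHom.inl _ _) :=
    addMonoidHom_pi_zmod_ext hfst
  have hinr : f.comp (AddMonoidHom.inr _ _) = g.comp (AddMonoidHom.inr _ _) :=
    addMonoidHom_pi_zmod_ext hsnd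
  rw [← AddMonoidHom.coprod_unique f, ← AddMonoidHom.coprod_unique g, hinl, hinr]

/-- The inner product with a fixed second argument, as a `ℤ₄`-valued character of `ℤ₂^α × ℤ₄^β`. -/
def innerHom (v : Z2Z4 α β) : Z2Z4 α β →+ ZMod 4 :=
  AddMonoidHom.mk' (innerZ4 · v) fun u u' => innerZ4_add_left u u' v

theorem innerHom_apply (u v : Z2Z4 α β) : innerHom v u = innerZ4 u v := rfl

theorem innerHom_bijective : Function.Bijective (innerHom (α := α) (β := β)) := by
  have double_inj : ∀ a b : ZMod 2, 2 * (a.val : ZMod 4) = 2 * (b.val : ZMod 4) → a = b := by decide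
  have half : ∀ y : ZMod 4, 2 • y = 0 → ∃ a : ZMod 2, 2 * (a.val : ZMod 4) = y := by decide
  constructor
  · intro v w h
    have hvw (u : Z2Z4 α β) : innerZ4 u v = innerZ4 u w := DFunLike.congr_fun h u
    refine Prod.ext (funext fun i => double_inj _ _ ?_) (funext fun j => ?_)
    · rw [← innerZ4_single_fst, hvw, innerZ4_single_fst]
    · rw [← innerZ4_single_snd, hvw, innerZ4_single_snd]
  · intro f
    have htors (i : Fin α) : 2 • f (Pi.single i 1, 0) = 0 := by
      have h2 : 2 • (1 : ZMod 2) = 0 := by decide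
      rw [← map_nsmul, Prod.smul_mk, ← Pi.single_smul, h2, Pi.single_zero, smul_zero,
        Prod.mk_zero_zero, map_zero]
    choose v hv using fun i => half _ (htors i)
    refine ⟨(v, fun j => f (0, Pi.single j 1)), addMonoidHom_Z2Z4_ext (fun i => ?_) fun j => ?_⟩
    · rw [innerHom_apply, innerZ4_single_fst, hv]
    · rw [innerHom_apply, innerZ4_single_snd]

theorem card_addMonoidHom_zmod_four {A : Type*} [AddCommGroup A] [Finite A]
    (hA : ∀ x : A, 4 • x = 0) : Nat.card (A →+ ZMod 4) = Nat.card A := by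
  obtain ⟨γ, δ, ⟨e⟩⟩ := exists_addEquiv_Z2Z4 hA
  rw [Nat.card_congr e.toEquiv, Nat.card_congr (Equiv.ofBijective innerHom innerHom_bijective),
    Nat.card_congr (AddEquiv.addMonoidHomCongrLeft e).toEquiv]

theorem mem_dualCode {C : AddSubgroup (Z2Z4 α β)} {v : Z2Z4 α β} :
    v ∈ dualCode C ↔ ∀ u ∈ C, innerZ4 u v = 0 := Iff.rfl

theorem card_dualCode (C : AddSubgroup (Z2Z4 α β)) :
    Nat.card (dualCode C) = Nat.card (Z2Z4 α β ⧸ C) := by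
  have h4 (x : Z2Z4 α β ⧸ C) : 4 • x = 0 := by
    obtain ⟨y, rfl⟩ := QuotientAddGroup.mk'_surjective C x
    rw [← map_nsmul, four_nsmul_Z2Z4, map_zero]
  let toChar (v : dualCode C) : Z2Z4 α β ⧸ C →+ ZMod 4 :=
    QuotientAddGroup.lift C (innerHom v.1) fun u hu => v.2 u hu
  have hbij : Function.Bijective toChar := by
    constructor
    · intro v w h
      refine Subtype.ext (innerHom_bijective.1 (AddMonoidHom.ext fun u => ?_))
      exact DFunLike.congr_fun h (QuotientAddGroup.mk' C u)
    · intro f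
      obtain ⟨v, hv⟩ := innerHom_bijective.2 (f.comp (QuotientAddGroup.mk' C))
      have hvC : v ∈ dualCode C := fun u hu => by
        rw [← innerHom_apply, hv, AddMonoidHom.comp_apply, QuotientAddGroup.mk'_apply,
          (QuotientAddGroup.eq_zero_iff u).2 hu, map_zero]
      exact ⟨⟨v, hvC⟩, QuotientAddGroup.addMonoidHom_ext _ hv⟩
  rw [Nat.card_congr (Equiv.ofBijective toChar hbij), card_addMonoidHom_zmod_four h4]

theorem card_dualCode_mul_card (C : AddSubgroup (Z2Z4 α β)) :
    Nat.card (dualCode C) * Nat.card C = 2 ^ (α + 2 * β) := by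
  rw [card_dualCode, ← AddSubgroup.card_eq_card_quotient_mul_card_addSubgroup, card_Z2Z4]

theorem dualCode_sup (C D : AddSubgroup (Z2Z4 α β)) :
    dualCode (C ⊔ D) = dualCode C ⊓ dualCode D := by
  ext v
  have hker (E : AddSubgroup (Z2Z4 α β)) : v ∈ dualCode E ↔ E ≤ (innerHom v).ker := Iff.rfl
  rw [AddSubgroup.mem_inf, hker, hker, hker, sup_le_iff]

theorem card_dualCode_inf_dualCode_mul (C D : AddSubgroup (Z2Z4 α β)) :
    Nat.card (dualCode C ⊓ dualCode D : AddSubgroup (Z2Z4 α β)) * (Nat.card C * Nat.card D) =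
      2 ^ (α + 2 * β) * Nat.card (C ⊓ D : AddSubgroup (Z2Z4 α β)) := by
  rw [← dualCode_sup, ← card_sup_mul_card_inf, ← mul_assoc, card_dualCode_mul_card]

theorem dualCode_doubles : dualCode (doubles (Z2Z4 α β)) = twoTorsion (Z2Z4 α β) := by
  ext v
  have hpair : v ∈ dualCode (doubles (Z2Z4 α β)) ↔ ∀ u, innerZ4 u (2 • v) = 0 := by
    simp only [mem_dualCode, mem_doubles, forall_exists_index, forall_apply_eq_imp_iff,
      innerZ4_two_nsmul_left]
  rw [hpair, mem_twoTorsion]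
  constructor
  · refine fun hv => innerHom_bijective.1 (AddMonoidHom.ext fun u => ?_)
    rw [innerHom_apply, innerHom_apply, hv, innerZ4_zero_right]
  · rintro hv u
    rw [hv, innerZ4_zero_right]

theorem dualCode_twoTorsion : dualCode (twoTorsion (Z2Z4 α β)) = doubles (Z2Z4 α β) := by
  have hle : doubles (Z2Z4 α β) ≤ dualCode (twoTorsion (Z2Z4 α β)) := by
    rintro _ ⟨v, rfl⟩ u hu
    have hpair : innerZ4 u (2 • v) = 0 := by
      rw [← innerZ4_two_nsmul_left, mem_twoTorsion.1 hu, innerZ4_comm, innerZ4_zero_right]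
    exact hpair
  refine (AddSubgroup.eq_of_le_of_card_ge hle (Nat.le_of_mul_le_mul_right ?_
    (Nat.card_pos (α := twoTorsion (Z2Z4 α β))))).symm
  rw [card_dualCode_mul_card, mul_comm (Nat.card _), card_twoTorsion_mul_card_doubles, card_Z2Z4]

variable {C : AddSubgroup (Z2Z4 α β)} {a b γ δ κ a' b' γ' δ' κ' : ℕ}

theorem IsOfType.eq_of_isOfType_dualCode (h : IsOfType C a b γ δ κ)
    (h' : IsOfType (dualCode C) a' b' γ' δ' κ') :
    γ' + 2 * κ = α + γ ∧ δ' + γ + δ = β + κ ∧ κ' + κ = α := by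
  have hcard : 2 ^ (γ' + 2 * δ' + (γ + 2 * δ)) = 2 ^ (α + 2 * β) := by
    rw [pow_add, ← h'.card_eq, ← h.card_eq, card_dualCode_mul_card]
  have htors : 2 ^ (γ' + δ' + (γ + 2 * δ + β) + κ) = 2 ^ (α + 2 * β + (γ + δ)) := by
    have hpair := card_dualCode_inf_dualCode_mul C (doubles (Z2Z4 α β))
    rw [dualCode_doubles, h'.card_inf_twoTorsion, h.card_eq, card_doubles_Z2Z4] at hpair
    rw [pow_add _ _ κ, pow_add _ _ (_ + β), pow_add _ _ β, hpair, mul_assoc,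
      h.card_inf_doubles_mul, pow_add _ _ (γ + δ)]
  have hdoub : 2 ^ (γ' + δ' + (γ + 2 * δ + (α + β))) = 2 ^ (α + 2 * β + (γ + δ) + κ') := by
    have hpair := card_dualCode_inf_dualCode_mul C (twoTorsion (Z2Z4 α β))
    rw [dualCode_twoTorsion, h.card_inf_twoTorsion, h.card_eq, card_twoTorsion_Z2Z4] at hpair
    rw [pow_add, ← h'.card_inf_doubles_mul, pow_add _ _ (α + β), mul_right_comm, hpair,
      pow_add _ _ κ', pow_add _ _ (γ + δ)]
  have hcard_exp := Nat.pow_right_injective le_rfl hcard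
  have htors_exp := Nat.pow_right_injective le_rfl htors
  have hdoub_exp := Nat.pow_right_injective le_rfl hdoub
  omega

theorem IsOfType.isOfType_dualCode_iff (h : IsOfType C a b γ δ κ) :
    IsOfType (dualCode C) a' b' γ' δ' κ' ↔
      a' = α ∧ b' = β ∧ γ' + 2 * κ = α + γ ∧ δ' + γ + δ = β + κ ∧ κ' + κ = α := by
  refine ⟨fun h' => ⟨h'.binary_coords.symm, h'.quaternary_coords.symm,
    h.eq_of_isOfType_dualCode h'⟩, ?_⟩
  rintro ⟨rfl, rfl, hγ, hδ, hκ⟩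
  obtain ⟨γ₀, δ₀, κ₀, h₀⟩ := exists_isOfType (dualCode C)
  obtain ⟨hγ₀, hδ₀, hκ₀⟩ := h.eq_of_isOfType_dualCode h₀
  obtain rfl : γ₀ = γ' := by omega
  obtain rfl : δ₀ = δ' := by omega
  obtain rfl : κ₀ = κ' := by omega
  exact h₀

end Duality

section HammingBall

variable {ι : Type*} [Fintype ι]

theorem hammingNorm_le_one_iff [DecidableEq ι] {x : ι → ZMod 2} :
    hammingNorm x ≤ 1 ↔ x = 0 ∨ ∃ i, Pi.single i 1 = x := by
  have eq_one : ∀ a : ZMod 2, a ≠ 0 → a = 1 := by decide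
  simp only [hammingNorm, Finset.card_le_one, Finset.mem_filter_univ]
  constructor
  · refine fun hx => or_iff_not_imp_left.2 fun hx0 => ?_
    obtain ⟨i, hi⟩ := Function.ne_iff.1 hx0
    refine ⟨i, funext fun k => ?_⟩
    by_cases hk : x k = 0
    · rw [hk, Pi.single_eq_of_ne (by rintro rfl; exact hi hk)]
    · rw [hx k hk i hi, Pi.single_eq_same, eq_one _ hi]
  · rintro (rfl | ⟨i, rfl⟩) j hj k hk
    · exact absurd rfl hj
    · rw [Pi.single_apply, ite_ne_right_iff] at hj hk
      rw [hj.1, hk.1]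

variable (ι) in
theorem ncard_setOf_hammingNorm_le_one :
    {x : ι → ZMod 2 | hammingNorm x ≤ 1}.ncard = Fintype.card ι + 1 := by
  classical
  have hball : {x : ι → ZMod 2 | hammingNorm x ≤ 1} =
      insert 0 (Set.range fun i => Pi.single i 1) :=
    Set.ext fun x => hammingNorm_le_one_iff
  have hinj : Function.Injective fun i => (Pi.single i 1 : ι → ZMod 2) := fun i j h => by
    simpa [Pi.single_apply] using congrFun h i
  have hzero : (0 : ι → ZMod 2) ∉ Set.range fun i => Pi.single i 1 := by
    rintro ⟨i, hi⟩
    exact one_ne_zero (Pi.single_eq_zero_iff.1 hi)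
  rw [hball, Set.ncard_insert_of_notMem hzero, Set.ncard_range_of_injective hinj,
    Nat.card_eq_fintype_card]

end HammingBall

section GrayMap

variable {α β : ℕ}

theorem grayMap_injective : Function.Injective (grayMap (α := α) (β := β)) := by
  have digit : Function.Injective grayDigit := by decide
  exact fun u v h => Prod.ext (funext fun i => congrFun h (.inl i)) <| funext fun j =>
    digit <| funext fun k => congrFun h (.inr (j, k))

theorem grayMap_bijective : Function.Bijective (grayMap (α := α) (β := β)) := by
  refine (Nat.bijective_iff_injective_and_card _).2 ⟨grayMap_injective, ?_⟩
  rw [card_Z2Z4]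
  simp [mul_comm]

theorem hammingNorm_grayMap (e : Z2Z4 α β) :
    hammingNorm (grayMap e) = hammingNorm e.1 + ∑ j, hammingNorm (grayDigit (e.2 j)) := by
  simp only [hammingNorm, Finset.card_filter, Fintype.sum_sum_type, Fintype.sum_prod_type]
  rfl

theorem hammingDist_grayMap (u v : Z2Z4 α β) :
    hammingDist (grayMap u) (grayMap v) =
      hammingDist u.1 v.1 + ∑ j, hammingDist (grayDigit (u.2 j)) (grayDigit (v.2 j)) := by
  simp only [hammingDist, Finset.card_filter, Fintype.sum_sum_type, Fintype.sum_prod_type]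
  rfl

theorem hammingNorm_grayMap_sub (u v : Z2Z4 α β) :
    hammingNorm (grayMap (u - v)) = hammingDist (grayMap u) (grayMap v) := by
  have digit : ∀ a b : ZMod 4,
      hammingNorm (grayDigit (a - b)) = hammingDist (grayDigit a) (grayDigit b) := by
    decide
  have binary : hammingNorm (u.1 - v.1) = hammingDist u.1 v.1 := by
    simp [hammingNorm, hammingDist, sub_eq_zero]
  rw [hammingNorm_grayMap, hammingDist_grayMap]
  exact congrArg₂ (· + ·) binary (Finset.sum_congr rfl fun j _ => digit _ _)

variable (α β) in
/-- The vectors of Lee weight at most one, i.e. those whose Gray image lies in the Hamming ball of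
radius one around `0`. -/
def leeBall : Set (Z2Z4 α β) := {e | hammingNorm (grayMap e) ≤ 1}

theorem mem_leeBall {e : Z2Z4 α β} : e ∈ leeBall α β ↔ hammingNorm (grayMap e) ≤ 1 := Iff.rfl

theorem sub_mem_leeBall {u v : Z2Z4 α β} :
    u - v ∈ leeBall α β ↔ hammingDist (grayMap u) (grayMap v) ≤ 1 := by
  rw [mem_leeBall, hammingNorm_grayMap_sub]

theorem neg_mem_leeBall {e : Z2Z4 α β} (he : e ∈ leeBall α β) : -e ∈ leeBall α β := by
  rw [← sub_zero e, sub_mem_leeBall] at he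
  rwa [← zero_sub, sub_mem_leeBall, hammingDist_comm]

variable (α β) in
theorem ncard_leeBall : (leeBall α β).ncard = α + 2 * β + 1 := by
  have hrange : {x | hammingNorm x ≤ 1} ⊆ Set.range (grayMap (α := α) (β := β)) := by
    rw [grayMap_bijective.surjective.range_eq]
    exact Set.subset_univ _
  have h := Set.ncard_preimage_of_injective_subset_range grayMap_injective hrange
  rw [ncard_setOf_hammingNorm_le_one] at h
  simpa [mul_comm β] using! h

variable (α β) in
theorem leeBall_inter_twoTorsion :
    leeBall α β ∩ twoTorsion (Z2Z4 α β) = (fun x => (x, 0)) '' {x | hammingNorm x ≤ 1} := by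
  have digit : ∀ a : ZMod 4, 2 • a = 0 → hammingNorm (grayDigit a) ≤ 1 → a = 0 := by decide
  have digit_zero : hammingNorm (grayDigit 0) = 0 := by decide
  have two_nsmul_zmod : ∀ a : ZMod 2, 2 • a = 0 := by decide
  ext e
  constructor
  · rintro ⟨he, htors⟩
    rw [mem_leeBall, hammingNorm_grayMap] at he
    have hsnd (j : Fin β) : e.2 j = 0 := by
      refine digit _ (congrFun (congrArg Prod.snd htors) j) ?_
      calc hammingNorm (grayDigit (e.2 j))
        _ ≤ ∑ j, hammingNorm (grayDigit (e.2 j)) :=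
          Finset.single_le_sum_of_canonicallyOrdered
            (f := fun j => hammingNorm (grayDigit (e.2 j))) (Finset.mem_univ j)
        _ ≤ 1 := (Nat.le_add_left _ _).trans he
    exact ⟨e.1, (Nat.le_add_right _ _).trans he, Prod.ext rfl (funext hsnd).symm⟩
  · rintro ⟨x, hx, rfl⟩
    refine ⟨?_, Prod.ext (funext fun i => two_nsmul_zmod _) (smul_zero 2)⟩
    rw [mem_leeBall, hammingNorm_grayMap]
    simpa [digit_zero] using! hx

variable (α β) in
theorem ncard_leeBall_inter_twoTorsion :
    (leeBall α β ∩ twoTorsion (Z2Z4 α β)).ncard = α + 1 := by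
  rw [leeBall_inter_twoTorsion, Set.ncard_image_of_injective _ (Prod.mk_left_injective 0),
    ncard_setOf_hammingNorm_le_one, Fintype.card_fin]

end GrayMap

section OnePerfect

variable {α β : ℕ} {C : AddSubgroup (Z2Z4 α β)}

theorem IsOnePerfect.existsUnique_sub_mem_leeBall (hC : IsOnePerfect C) (v : Z2Z4 α β) :
    ∃! c, c ∈ C ∧ v - c ∈ leeBall α β := by
  obtain ⟨_, ⟨⟨c, hc, rfl⟩, hvc⟩, huniq⟩ := hC (grayMap v)
  refine ⟨c, ⟨hc, sub_mem_leeBall.2 hvc⟩, fun c' hc' => grayMap_injective ?_⟩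
  exact huniq _ ⟨Set.mem_image_of_mem _ hc'.1, sub_mem_leeBall.1 hc'.2⟩

theorem IsOnePerfect.bijOn_mk (hC : IsOnePerfect C) :
    Set.BijOn (QuotientAddGroup.mk' C) (leeBall α β) Set.univ := by
  refine ⟨Set.mapsTo_univ _ _, fun e he e' he' hee' => ?_, fun q _ => ?_⟩
  · have hmem : e - e' ∈ C := by
      rw [← QuotientAddGroup.ker_mk' C, AddMonoidHom.mem_ker, map_sub, hee', sub_self]
    refine sub_eq_zero.1 ((hC.existsUnique_sub_mem_leeBall e).unique ⟨hmem, ?_⟩ ⟨C.zero_mem, ?_⟩)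
    · rwa [sub_sub_cancel]
    · rwa [sub_zero]
  · obtain ⟨v, rfl⟩ := QuotientAddGroup.mk'_surjective C q
    obtain ⟨c, ⟨hc, hvc⟩, -⟩ := hC.existsUnique_sub_mem_leeBall v
    refine ⟨v - c, hvc, ?_⟩
    rw [map_sub, sub_eq_self, ← AddMonoidHom.mem_ker, QuotientAddGroup.ker_mk']
    exact hc

theorem IsOnePerfect.bijOn_mk_twoTorsion (hC : IsOnePerfect C) :
    Set.BijOn (QuotientAddGroup.mk' C) (leeBall α β ∩ twoTorsion (Z2Z4 α β))
      (twoTorsion (Z2Z4 α β ⧸ C)) :=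
  bijOn_inter_twoTorsion (fun _ => neg_mem_leeBall) hC.bijOn_mk

theorem IsOnePerfect.card_quotient (hC : IsOnePerfect C) :
    Nat.card (Z2Z4 α β ⧸ C) = α + 2 * β + 1 := by
  rw [← Set.ncard_univ, ← hC.bijOn_mk.ncard_eq, ncard_leeBall]

theorem IsOnePerfect.card_twoTorsion_quotient (hC : IsOnePerfect C) :
    Nat.card (twoTorsion (Z2Z4 α β ⧸ C)) = α + 1 := by
  rw [← ncard_leeBall_inter_twoTorsion α β, hC.bijOn_mk_twoTorsion.ncard_eq]
  exact Nat.card_coe_set_eq _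

theorem IsOnePerfect.map_twoTorsion (hC : IsOnePerfect C) :
    (twoTorsion (Z2Z4 α β)).map (QuotientAddGroup.mk' C) = twoTorsion (Z2Z4 α β ⧸ C) := by
  refine le_antisymm ?_ ?_
  · rintro _ ⟨x, hx, rfl⟩
    rw [mem_twoTorsion, ← map_nsmul, mem_twoTorsion.1 hx, map_zero]
  · intro q hq
    obtain ⟨x, hx, rfl⟩ := hC.bijOn_mk_twoTorsion.surjOn hq
    exact ⟨x, hx.2, rfl⟩

variable {a b γ δ κ r t : ℕ}

theorem IsOnePerfect.eq_of_isOfType (hC : IsOnePerfect C) (hr : α + 1 = 2 ^ r)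
    (ht : α + 2 * β + 1 = 2 ^ t) (h : IsOfType C a b γ δ κ) :
    γ + 2 * r = α + t ∧ δ + t = β + r ∧ κ = γ := by
  have hcard : 2 ^ (t + (γ + 2 * δ)) = 2 ^ (α + 2 * β) := by
    rw [pow_add, ← ht, ← hC.card_quotient, ← h.card_eq, ← card_Z2Z4]
    exact (AddSubgroup.card_eq_card_quotient_mul_card_addSubgroup C).symm
  have htors : 2 ^ (γ + δ + r) = 2 ^ (α + β) := by
    rw [pow_add, ← h.card_inf_twoTorsion, ← hr, ← hC.card_twoTorsion_quotient, ← hC.map_twoTorsion,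
      card_inf_mul_card_map_mk, card_twoTorsion_Z2Z4]
  have hdoub : 2 ^ (β + r + κ) = 2 ^ (γ + δ + t) := by
    have hquot := card_twoTorsion_mul_card_doubles (Z2Z4 α β ⧸ C)
    have hcode := card_inf_mul_card_map_mk C (doubles (Z2Z4 α β))
    rw [map_doubles_of_surjective (QuotientAddGroup.mk'_surjective C), card_doubles_Z2Z4] at hcode
    rw [hC.card_twoTorsion_quotient, hC.card_quotient, hr, ht] at hquot
    rw [pow_add, pow_add, ← hcode, pow_add (2 : ℕ) (γ + δ), ← hquot, ← h.card_inf_doubles_mul]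
    ring
  have hcard_exp := Nat.pow_right_injective le_rfl hcard
  have htors_exp := Nat.pow_right_injective le_rfl htors
  have hdoub_exp := Nat.pow_right_injective le_rfl hdoub
  omega

theorem IsOnePerfect.isOfType_iff (hC : IsOnePerfect C) (hr : α + 1 = 2 ^ r)
    (ht : α + 2 * β + 1 = 2 ^ t) :
    IsOfType C a b γ δ κ ↔
      a = α ∧ b = β ∧ γ + 2 * r = α + t ∧ δ + t = β + r ∧ κ = γ := by
  refine ⟨fun h => ⟨h.binary_coords.symm, h.quaternary_coords.symm,
    hC.eq_of_isOfType hr ht h⟩, ?_⟩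
  rintro ⟨rfl, rfl, hγ, hδ, hκ⟩
  obtain ⟨γ₀, δ₀, κ₀, h₀⟩ := exists_isOfType C
  obtain ⟨hγ₀, hδ₀, hκ₀⟩ := hC.eq_of_isOfType hr ht h₀
  obtain rfl : γ₀ = γ := by omega
  obtain rfl : δ₀ = δ := by omega
  obtain rfl : κ₀ = κ := by omega
  exact h₀

theorem IsOnePerfect.isOfType_dualCode_iff (hC : IsOnePerfect C) (hr : α + 1 = 2 ^ r)
    (ht : α + 2 * β + 1 = 2 ^ t) :
    IsOfType (dualCode C) a b γ δ κ ↔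
      a = α ∧ b = β ∧ γ + t = 2 * r ∧ δ + r = t ∧ κ = γ := by
  obtain ⟨γ₀, δ₀, κ₀, h₀⟩ := exists_isOfType C
  obtain ⟨hγ₀, hδ₀, hκ₀⟩ := hC.eq_of_isOfType hr ht h₀
  rw [h₀.isOfType_dualCode_iff]
  omega

end OnePerfect

theorem proposition2p3 (r t : ℕ) (hr : 2 ≤ r) (hrt : r ≤ t) (htr : t ≤ 2 * r)
    (α β : ℕ) (hα : α = 2 ^ r - 1) (hlen : α + 2 * β = 2 ^ t - 1)
    (C : AddSubgroup (Z2Z4 α β)) (hC : IsOnePerfect C) :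
    (∀ a b γ δ κ : ℕ, IsOfType C a b γ δ κ ↔
      ((a : ℤ) = 2 ^ r - 1 ∧ (b : ℤ) = 2 ^ (t - 1) - 2 ^ (r - 1) ∧
        (γ : ℤ) = 2 ^ r - 1 - 2 * r + t ∧
        (δ : ℤ) = 2 ^ (t - 1) - 2 ^ (r - 1) + r - t ∧
        κ = γ)) ∧
    (∀ a b γ δ κ : ℕ, IsOfType (dualCode C) a b γ δ κ ↔
      (a = α ∧ b = β ∧ (γ : ℤ) = 2 * r - t ∧ (δ : ℤ) = t - r ∧ κ = γ)) := by
  have hα' : α + 1 = 2 ^ r := by have := Nat.two_pow_pos r; omega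
  have hlen' : α + 2 * β + 1 = 2 ^ t := by have := Nat.two_pow_pos t; omega
  have hr_half : 2 ^ r = 2 * 2 ^ (r - 1) := by rw [← pow_succ', Nat.sub_add_cancel (by omega)]
  have ht_half : 2 ^ t = 2 * 2 ^ (t - 1) := by rw [← pow_succ', Nat.sub_add_cancel (by omega)]
  constructor <;> intro a b γ δ κ
  · rw [hC.isOfType_iff hα' hlen']
    zify at hα' hlen' hr_half ht_half ⊢
    omega
  · rw [hC.isOfType_dualCode_iff hα' hlen']
    omega
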